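/- Let $\mathcal E_3$ be the ring of germs at the origin of $C^\infty$ functions on $\mathbb R^3$, with coordinates $(u,v,w)$, and let $X=\{(u,v,w): v^3=w^2\}=\{(x,y^2,y^3):x,y\in\mathbb R\}$ be the standard cuspidal edge. Let $I(X)\subset\mathcal E_3$ be the ideal of the germs that vanish on $X$ near the origin, and let $\Theta(X)$ be the $\mathcal E_3$-module of germs at the origin of smooth vector fields on $\mathbb R^3$ tangent to $X$, that is, of those $\xi$ with $\xi f\in I(X)$ for every $f\in I(X)$. Then the $\mathcal E_3$-module $\Theta(X)$ is generated by the three vector fields $$\xi_1=\frac{\partial}{\partial u},\qquad \xi_2=2v\frac{\partial}{\partial v}+3w\frac{\partial}{\partial w},\qquad \xi_3=2w\frac{\partial}{\partial v}+3v^2\frac{\partial}{\partial w}.$$ -/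

import Mathlib

open scoped Topology ContDiff

namespace CuspidalEdge

/-- The local ring of germs at the origin of smooth functions on `ℝⁿ`. A germ belongs to it
when it has a representative which is `C^∞` on some open neighbourhood of the origin. -/
def SmoothGerm (n : ℕ) : Subring (Filter.Germ (𝓝 (0 : Fin n → ℝ)) ℝ) where
  carrier := {φ | ∃ (f : (Fin n → ℝ) → ℝ) (U : Set (Fin n → ℝ)),
    IsOpen U ∧ 0 ∈ U ∧ ContDiffOn ℝ ∞ f U ∧ φ = (f : Filter.Germ (𝓝 (0 : Fin n → ℝ)) ℝ)}
  mul_mem' := by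
    rintro _ _ ⟨f, U, hU, h0, hf, rfl⟩ ⟨g, V, hV, h0', hg, rfl⟩
    exact ⟨f * g, U ∩ V, hU.inter hV, ⟨h0, h0'⟩,
      (hf.mono Set.inter_subset_left).mul (hg.mono Set.inter_subset_right), rfl⟩
  one_mem' := ⟨1, Set.univ, isOpen_univ, trivial, contDiffOn_const, rfl⟩
  add_mem' := by
    rintro _ _ ⟨f, U, hU, h0, hf, rfl⟩ ⟨g, V, hV, h0', hg, rfl⟩
    exact ⟨f + g, U ∩ V, hU.inter hV, ⟨h0, h0'⟩,
      (hf.mono Set.inter_subset_left).add (hg.mono Set.inter_subset_right), rfl⟩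
  zero_mem' := ⟨0, Set.univ, isOpen_univ, trivial, contDiffOn_const, rfl⟩
  neg_mem' := by
    rintro _ ⟨f, U, hU, h0, hf, rfl⟩
    exact ⟨-f, U, hU, h0, hf.neg, rfl⟩

/-- The germ of the `i`-th coordinate function. -/
def coord {n : ℕ} (i : Fin n) : SmoothGerm n :=
  ⟨((fun x : Fin n → ℝ => x i) : Filter.Germ (𝓝 (0 : Fin n → ℝ)) ℝ),
    fun x => x i, Set.univ, isOpen_univ, trivial, (contDiff_apply ℝ ℝ i).contDiffOn, rfl⟩

/-- The `i`-th partial derivative of a germ of functions, computed on representatives. -/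
noncomputable def germPartial {n : ℕ} (i : Fin n) (φ : Filter.Germ (𝓝 (0 : Fin n → ℝ)) ℝ) :
    Filter.Germ (𝓝 (0 : Fin n → ℝ)) ℝ :=
  Filter.Germ.map' (fun (f : (Fin n → ℝ) → ℝ) x => fderiv ℝ f x (Pi.single i 1))
    (fun _ _ h => h.fderiv.mono fun x hx => by
      show fderiv ℝ _ x _ = fderiv ℝ _ x _
      rw [hx]) φ

/-- The `i`-th partial derivative of a germ of smooth functions. -/
noncomputable def partialDeriv {n : ℕ} (i : Fin n) (φ : SmoothGerm n) : SmoothGerm n :=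
  ⟨germPartial i φ.1, by
    obtain ⟨_, f, U, hU, h0, hf, rfl⟩ := φ
    exact ⟨fun x => fderiv ℝ f x (Pi.single i 1), U, hU, h0,
      (hf.fderiv_of_isOpen hU (by simp)).clm_apply contDiffOn_const, rfl⟩⟩

/-- The ideal of germs of smooth functions that vanish on (the germ at the origin of) `X`. -/
def vanishingIdeal {n : ℕ} (X : Set (Fin n → ℝ)) : Ideal (SmoothGerm n) where
  carrier := {φ | ∃ f : (Fin n → ℝ) → ℝ,
    φ.1 = (f : Filter.Germ (𝓝 (0 : Fin n → ℝ)) ℝ) ∧ ∀ᶠ x in 𝓝 (0 : Fin n → ℝ), x ∈ X → f x = 0}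
  add_mem' := by
    rintro ⟨_, _⟩ ⟨_, _⟩ ⟨f, rfl, hf⟩ ⟨g, rfl, hg⟩
    refine ⟨f + g, rfl, ?_⟩
    filter_upwards [hf, hg] with x h1 h2 hx
    simp [h1 hx, h2 hx]
  zero_mem' := ⟨0, rfl, by simp⟩
  smul_mem' := by
    rintro ⟨_, g, _, _, _, _, rfl⟩ ⟨_, _⟩ ⟨f, rfl, hf⟩
    refine ⟨g * f, rfl, ?_⟩
    filter_upwards [hf] with x h1 hx
    simp [h1 hx]

/-- Germs at the origin of smooth vector fields on `ℝⁿ`, as a module over the ring of germs of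
smooth functions: `ξ` stands for the vector field `∑ i, ξ i ∂/∂xᵢ`. -/
abbrev VectorFieldGerm (n : ℕ) : Type := Fin n → SmoothGerm n

/-- The coordinate vector field `∂/∂xᵢ`. -/
noncomputable def coordField {n : ℕ} (i : Fin n) : VectorFieldGerm n := Pi.single i 1

/-- The derivative `ξ f = ∑ i, ξ i ∂f/∂xᵢ` of a function germ along a vector field germ. -/
noncomputable def lieApply {n : ℕ} (ξ : VectorFieldGerm n) (f : SmoothGerm n) : SmoothGerm n :=
  ∑ i, ξ i * partialDeriv i f

/-- The module of germs of smooth vector fields tangent to (the germ at the origin of) `X`: the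
vector fields that map every function germ vanishing on `X` to one vanishing on `X`. -/
noncomputable def tangentFields {n : ℕ} (X : Set (Fin n → ℝ)) :
    Submodule (SmoothGerm n) (VectorFieldGerm n) where
  carrier := {ξ | ∀ f ∈ vanishingIdeal X, lieApply ξ f ∈ vanishingIdeal X}
  add_mem' := by
    intro ξ η hξ hη f hf
    have : lieApply (ξ + η) f = lieApply ξ f + lieApply η f := by
      simp [lieApply, add_mul, Finset.sum_add_distrib]
    rw [this]
    exact add_mem (hξ f hf) (hη f hf)
  zero_mem' := by
    intro f _
    simp [lieApply]
  smul_mem' := by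
    intro c ξ hξ f hf
    have : lieApply (c • ξ) f = c * lieApply ξ f := by
      simp [lieApply, Finset.mul_sum, mul_assoc]
    rw [this]
    exact Ideal.mul_mem_left _ _ (hξ f hf)

/-- The cuspidal edge `v³ = w²` in `ℝ³` with coordinates `(u, v, w)`. -/
def cuspidalEdge : Set (Fin 3 → ℝ) := {p | p 1 ^ 3 = p 2 ^ 2}

/-- `ξ₁ = ∂/∂u`. -/
noncomputable def xi₁ : VectorFieldGerm 3 := coordField 0

/-- `ξ₂ = 2v ∂/∂v + 3w ∂/∂w`. -/
noncomputable def xi₂ : VectorFieldGerm 3 :=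
  (2 * coord 1 : SmoothGerm 3) • coordField 1 + (3 * coord 2 : SmoothGerm 3) • coordField 2

/-- `ξ₃ = 2w ∂/∂v + 3v² ∂/∂w`. -/
noncomputable def xi₃ : VectorFieldGerm 3 :=
  (2 * coord 2 : SmoothGerm 3) • coordField 1 + (3 * coord 1 ^ 2 : SmoothGerm 3) • coordField 2

end CuspidalEdge

namespace CuspidalEdge

/-! The heart is that `I(X)` is generated by `h = v³ - w²`
(`exists_contDiff_eq_mul_of_eqOn_cuspidalEdge`). If `f` vanishes on `X`, then `f(u, y², w) = (y⁶ -
w²) Q(u, y, w)` with `Q` smooth. Subtracting `h Q(u, 0, w)` leaves a multiple `v g` with `g = 0` on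
`X`; iterating, `f = h a + v ^ N g`. For `N` large, `v ^ N g / h` is `C^k`: it is `v ^ N Q(u, √v,
w)`, with `Q` now taken for `g`, where `v > 0`, and `h` vanishes only on the axis `v = w = 0` where
`v ≤ 0`. The quotient is unique, hence independent of `k`, hence smooth.

If `a ∂u + b ∂v + c ∂w` is tangent, then `3v²b = 2wc` on `X`. This forces `b = 0` on the axis, so `b
= v b₁ + w b₂`. Subtracting `a ξ₁ + (b₁ ξ₂ + b₂ ξ₃) / 2` leaves a multiple of `∂w` whose coefficient
vanishes on `X`, thus equals `h q`; and `3h ∂w = v ξ₃ - w ξ₂`. -/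

/-! ### Parametric integrals and Hadamard's lemma. -/

theorem hasFDerivAt_integral_of_contDiff {E F : Type} [NormedAddCommGroup E] [NormedSpace ℝ E]
    [ProperSpace E] [NormedAddCommGroup F] [NormedSpace ℝ F] {f : E × ℝ → F} (hf : ContDiff ℝ 1 f)
    (x₀ : E) :
    HasFDerivAt (fun x => ∫ t in (0 : ℝ)..1, f (x, t))
      (∫ t in (0 : ℝ)..1, (fderiv ℝ f (x₀, t)).comp (ContinuousLinearMap.inl ℝ E ℝ)) x₀ := by
  have hf' : Continuous fun p => (fderiv ℝ f p).comp (ContinuousLinearMap.inl ℝ E ℝ) :=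
    (hf.continuous_fderiv one_ne_zero).clm_comp continuous_const
  obtain ⟨C, hC⟩ := ((isCompact_closedBall x₀ 1).prod
    (isCompact_Icc (a := (0 : ℝ)) (b := 1))).bddAbove_image hf'.norm.continuousOn
  refine intervalIntegral.hasFDerivAt_integral_of_dominated_of_fderiv_le (bound := fun _ => C)
    (F' := fun x t => (fderiv ℝ f (x, t)).comp (ContinuousLinearMap.inl ℝ E ℝ))
    (Metric.closedBall_mem_nhds x₀ one_pos)
    (Filter.Eventually.of_forall fun x =>
      (hf.continuous.comp (by fun_prop : Continuous fun t : ℝ => (x, t))).aestronglyMeasurable)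
    ((hf.continuous.comp (by fun_prop : Continuous fun t : ℝ => (x₀, t))).intervalIntegrable _ _)
    (hf'.comp (by fun_prop : Continuous fun t : ℝ => (x₀, t))).aestronglyMeasurable
    (Filter.Eventually.of_forall fun t ht x hx => hC ⟨(x, t), ⟨hx, ?_⟩, rfl⟩)
    intervalIntegrable_const
    (Filter.Eventually.of_forall fun t ht x hx => ?_)
  · rw [Set.uIoc_of_le zero_le_one] at ht
    exact ⟨ht.1.le, ht.2⟩
  · exact ((hf.differentiable one_ne_zero) (x, t)).hasFDerivAt.comp x
      (hasFDerivAt_prodMk_left x t)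

theorem contDiff_integral_of_contDiff {E : Type} [NormedAddCommGroup E] [NormedSpace ℝ E]
    [ProperSpace E] (n : ℕ) {F : Type} [NormedAddCommGroup F] [NormedSpace ℝ F] {f : E × ℝ → F}
    (hf : ContDiff ℝ n f) : ContDiff ℝ n fun x => ∫ t in (0 : ℝ)..1, f (x, t) := by
  induction n generalizing F with
  | zero =>
    simp only [CharP.cast_eq_zero, contDiff_zero] at hf ⊢
    exact intervalIntegral.continuous_parametric_intervalIntegral_of_continuous'
      (f := fun x t => f (x, t)) hf 0 1
  | succ n ih =>
    push_cast at hf ⊢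
    rw [contDiff_succ_iff_hasFDerivAt]
    exact ⟨_, ih ((hf.fderiv_right le_rfl).clm_comp contDiff_const),
      hasFDerivAt_integral_of_contDiff (hf.of_le (by simp))⟩

/-- Hadamard's lemma: the increments of a smooth function are smoothly divisible. -/
theorem exists_contDiff_sub_eq_apply {E F : Type} [NormedAddCommGroup E] [NormedSpace ℝ E]
    [ProperSpace E] [NormedAddCommGroup F] [NormedSpace ℝ F] [CompleteSpace F] {f : E → F}
    (hf : ContDiff ℝ ∞ f) :
    ∃ B : E × E → E →L[ℝ] F, ContDiff ℝ ∞ B ∧ ∀ x y, f x - f y = B (x, y) (x - y) := by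
  have hs : ContDiff ℝ ∞ fun p : (E × E) × ℝ => fderiv ℝ f (p.1.2 + p.2 • (p.1.1 - p.1.2)) :=
    (hf.fderiv_right (m := ∞) (by simp)).comp (by fun_prop)
  refine ⟨fun p => ∫ t in (0 : ℝ)..1, fderiv ℝ f (p.2 + t • (p.1 - p.2)),
    contDiff_infty.2 fun n => contDiff_integral_of_contDiff n (contDiff_infty.1 hs n),
    fun x y => ?_⟩
  have hc : Continuous fun t : ℝ => fderiv ℝ f (y + t • (x - y)) :=
    hs.continuous.comp (by fun_prop : Continuous fun t : ℝ => ((x, y), t))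
  change _ = (∫ t in (0 : ℝ)..1, fderiv ℝ f (y + t • (x - y))) (x - y)
  rw [ContinuousLinearMap.intervalIntegral_apply (hc.intervalIntegrable 0 1),
    intervalIntegral.integral_eq_sub_of_hasDerivAt (f := fun t : ℝ => f (y + t • (x - y)))]
  · simp
  · intro t _
    have h := ((hf.differentiable (by simp)) (y + t • (x - y))).hasFDerivAt.comp_hasDerivAt t
      (((hasDerivAt_id t).smul_const (x - y)).const_add y)
    simpa [Function.comp_def] using h
  · exact (hc.clm_apply continuous_const).intervalIntegrable 0 1

/-! ### Finite smoothness of extensions by zero across a hyperplane. -/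

/-- The function `ℓ ^ N • A (x, φ x)` on the half space `0 < ℓ`, extended by zero. -/
noncomputable def flatExtension {E F : Type} [NormedAddCommGroup E] [NormedSpace ℝ E]
    [NormedAddCommGroup F] [NormedSpace ℝ F] (ℓ : E →L[ℝ] ℝ) (φ : E → ℝ) (N : ℕ) (A : E × ℝ → F)
    (x : E) : F :=
  open Classical in if 0 < ℓ x then ℓ x ^ N • A (x, φ x) else 0

section Flat

variable {E : Type} [NormedAddCommGroup E] [NormedSpace ℝ E] [ProperSpace E] {ℓ : E →L[ℝ] ℝ}
  {φ : E → ℝ}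

theorem flatExtension_isBigO {F : Type} [NormedAddCommGroup F] [NormedSpace ℝ F]
    (hb : ∀ x₀, ∃ C, ∀ᶠ x in 𝓝 x₀, 0 < ℓ x → |φ x| ≤ C) (N : ℕ) {A : E × ℝ → F}
    (hA : Continuous A) {x₀ : E} (hx₀ : ¬ 0 < ℓ x₀) :
    flatExtension ℓ φ N A =O[𝓝 x₀] fun x => ‖x - x₀‖ ^ N := by
  obtain ⟨C, hC⟩ := hb x₀
  obtain ⟨D, hD⟩ := ((isCompact_closedBall x₀ 1).prod
    (isCompact_Icc (a := -C) (b := C))).bddAbove_image hA.norm.continuousOn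
  refine Asymptotics.IsBigO.of_bound (‖ℓ‖ ^ N * |D|) ?_
  filter_upwards [hC, Metric.closedBall_mem_nhds x₀ one_pos] with x hx hx1
  unfold flatExtension
  split_ifs with h
  · have h1 : ‖A (x, φ x)‖ ≤ |D| :=
      (hD ⟨(x, φ x), ⟨hx1, abs_le.1 (hx h)⟩, rfl⟩).trans (le_abs_self D)
    have h2 : ℓ x ≤ ‖ℓ‖ * ‖x - x₀‖ := by
      have := (le_abs_self _).trans (ℓ.le_opNorm (x - x₀))
      rw [map_sub] at this
      linarith
    rw [norm_smul, norm_pow, Real.norm_of_nonneg h.le, norm_pow, norm_norm]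
    calc ℓ x ^ N * ‖A (x, φ x)‖ ≤ (‖ℓ‖ * ‖x - x₀‖) ^ N * |D| := by gcongr
      _ = _ := by ring
  · rw [norm_zero]
    positivity

/-- The derivative of `φ` may blow up at the boundary, but `ℓ³ dφ` is a smooth function of `(x, φ
x)`. So differentiating gives a function of the same shape with the exponent lowered by 3, and
induction on `k` applies. -/
theorem contDiff_flatExtension {m : E × ℝ → E →L[ℝ] ℝ} (hm : ContDiff ℝ ∞ m)
    (hb : ∀ x₀, ∃ C, ∀ᶠ x in 𝓝 x₀, 0 < ℓ x → |φ x| ≤ C)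
    (hφ : ∀ x, 0 < ℓ x → ∃ φ', HasFDerivAt φ φ' x ∧ ℓ x ^ 3 • φ' = m (x, φ x))
    (k : ℕ) {F : Type} [NormedAddCommGroup F] [NormedSpace ℝ F] {A : E × ℝ → F}
    (hA : ContDiff ℝ ∞ A) {N : ℕ} (hN : 3 * k + 2 ≤ N) :
    ContDiff ℝ k (flatExtension ℓ φ N A) := by
  have hpos : IsOpen {x | 0 < ℓ x} := isOpen_lt continuous_const ℓ.continuous
  induction k generalizing F N with
  | zero =>
    simp only [CharP.cast_eq_zero, contDiff_zero, continuous_iff_continuousAt]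
    intro x₀
    by_cases hx₀ : 0 < ℓ x₀
    · obtain ⟨φ', hφ', -⟩ := hφ x₀ hx₀
      have : ContinuousAt (fun x => ℓ x ^ N • A (x, φ x)) x₀ :=
        (ℓ.continuous.continuousAt.pow N).smul
          (hA.continuous.continuousAt.comp (continuousAt_id.prodMk hφ'.continuousAt))
      refine this.congr ?_
      filter_upwards [hpos.mem_nhds hx₀] with x hx
      exact (if_pos hx).symm
    · have h0 : flatExtension ℓ φ N A x₀ = 0 := if_neg hx₀
      rw [ContinuousAt, h0]
      refine (flatExtension_isBigO hb N hA.continuous hx₀).trans_tendsto ?_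
      have : Continuous fun x => ‖x - x₀‖ ^ N := by fun_prop
      convert this.tendsto x₀ using 2
      rw [sub_self, norm_zero, zero_pow (by lia)]
  | succ k ih =>
    obtain ⟨N, rfl⟩ : ∃ M, N = M + 3 := ⟨N - 3, by lia⟩
    push_cast
    rw [contDiff_succ_iff_hasFDerivAt]
    -- Product and chain rules for `ℓ ^ (N + 3) • A (x, φ x)`, with `ℓ ^ N` factored out and `m` in
    -- place of `ℓ³ dφ`.
    refine ⟨flatExtension ℓ φ N fun z => ((N + 3 : ℝ) * ℓ z.1 ^ 2) • ℓ.smulRight (A z) +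
      ℓ z.1 ^ 3 • (fderiv ℝ A z).comp (ContinuousLinearMap.inl ℝ E ℝ) +
      (m z).smulRight (fderiv ℝ A z (0, 1)),
      ih ?_ (by lia), fun x₀ => ?_⟩
    · have h1 : ContDiff ℝ ∞ fun z : E × ℝ => ℓ z.1 := ℓ.contDiff.comp contDiff_fst
      have h2 : ContDiff ℝ ∞ (fderiv ℝ A) := hA.fderiv_right (by simp)
      exact (((contDiff_const.mul (h1.pow 2)).smul (contDiff_const.smulRight hA)).add
        ((h1.pow 3).smul (h2.clm_comp contDiff_const))).add
          (hm.smulRight (h2.clm_apply contDiff_const))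
    · by_cases hx₀ : 0 < ℓ x₀
      · obtain ⟨φ', hφ', hm'⟩ := hφ x₀ hx₀
        have h1 := ((ℓ.hasFDerivAt (x := x₀)).pow (N + 3)).smul
          (((hA.differentiable (by simp)) (x₀, φ x₀)).hasFDerivAt.comp x₀
            ((hasFDerivAt_id x₀).prodMk hφ'))
        have h2 : flatExtension ℓ φ (N + 3) A =ᶠ[𝓝 x₀] fun x => ℓ x ^ (N + 3) • A (x, φ x) := by
          filter_upwards [hpos.mem_nhds hx₀] with x hx
          exact if_pos hx
        refine (h1.congr_of_eventuallyEq h2).congr_fderiv ?_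
        rw [flatExtension, if_pos hx₀, ← hm']
        ext v
        have h3 : fderiv ℝ A (x₀, φ x₀) (v, φ' v) =
            fderiv ℝ A (x₀, φ x₀) (v, 0) + φ' v • fderiv ℝ A (x₀, φ x₀) (0, 1) := by
          rw [← map_smul, ← map_add]
          simp
        simp [h3, smul_smul]
        module
      · rw [flatExtension, if_neg hx₀]
        exact (flatExtension_isBigO hb (N + 3) hA.continuous hx₀).hasFDerivAt (by lia)

end Flat

/-! ### Division along a coordinate. -/

theorem eq_zero_of_forall_ne_zero {f : ℝ → ℝ} (hf : Continuous f) (h : ∀ t, t ≠ 0 → f t = 0) :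
    f 0 = 0 :=
  congrFun (hf.ext_on (dense_compl_singleton (0 : ℝ)) continuous_const h) 0

theorem contDiff_update {n : ℕ} (i : Fin n) {s : (Fin n → ℝ) → ℝ} (hs : ContDiff ℝ ∞ s) :
    ContDiff ℝ ∞ fun x => Function.update x i (s x) := by
  refine contDiff_pi.2 fun j => ?_
  by_cases h : j = i
  · subst h
    simpa using hs
  · simpa [h] using contDiff_apply ℝ ℝ j

theorem contDiff_vec3 {E : Type} [NormedAddCommGroup E] [NormedSpace ℝ E] {a b c : E → ℝ}
    (ha : ContDiff ℝ ∞ a) (hb : ContDiff ℝ ∞ b) (hc : ContDiff ℝ ∞ c) :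
    ContDiff ℝ ∞ fun x => ![a x, b x, c x] := by
  refine contDiff_pi.2 fun j => ?_
  fin_cases j
  exacts [ha, hb, hc]

theorem exists_contDiff_sub_update {n : ℕ} (i : Fin n) {f s : (Fin n → ℝ) → ℝ}
    (hf : ContDiff ℝ ∞ f) (hs : ContDiff ℝ ∞ s) :
    ∃ q : (Fin n → ℝ) → ℝ, ContDiff ℝ ∞ q ∧
      ∀ x, f x - f (Function.update x i (s x)) = (x i - s x) * q x := by
  obtain ⟨B, hB, h⟩ := exists_contDiff_sub_eq_apply hf
  refine ⟨fun x => B (x, Function.update x i (s x)) (Pi.single i 1),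
    (hB.comp (contDiff_id.prodMk (contDiff_update i hs))).clm_apply contDiff_const, fun x => ?_⟩
  rw [h, ← smul_eq_mul, ← map_smul]
  congr 1
  ext j
  by_cases hj : j = i
  · subst hj
    simp
  · simp [hj]

/-- A smooth function vanishing on the graph `xᵢ = s` is divisible by `xᵢ - s`. -/
theorem exists_contDiff_eq_sub_mul {n : ℕ} (i : Fin n) {f s : (Fin n → ℝ) → ℝ}
    (hf : ContDiff ℝ ∞ f) (hs : ContDiff ℝ ∞ s) (h : ∀ x, f (Function.update x i (s x)) = 0) :
    ∃ q : (Fin n → ℝ) → ℝ, ContDiff ℝ ∞ q ∧ ∀ x, f x = (x i - s x) * q x := by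
  obtain ⟨q, hq, hfq⟩ := exists_contDiff_sub_update i hf hs
  exact ⟨q, hq, fun x => by simpa [h] using hfq x⟩

/-! ### Functions vanishing on the cuspidal edge. -/

theorem mem_cuspidalEdge_iff {x : Fin 3 → ℝ} : x ∈ cuspidalEdge ↔ x 1 ^ 3 = x 2 ^ 2 := Iff.rfl

theorem vec3_mem_cuspidalEdge (u y : ℝ) : ![u, y ^ 2, y ^ 3] ∈ cuspidalEdge := by
  rw [mem_cuspidalEdge_iff]
  simp
  ring

/-- Under `v = y²` the edge pulls back to the two graphs `w = ± y³`, and each factor is divided out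
in turn. The graphs meet at `y = 0`, where the second vanishing follows by continuity. -/
theorem exists_contDiff_pullback_eq_mul {f : (Fin 3 → ℝ) → ℝ} (hf : ContDiff ℝ ∞ f)
    (hX : ∀ x ∈ cuspidalEdge, f x = 0) :
    ∃ Q : (Fin 3 → ℝ) → ℝ, ContDiff ℝ ∞ Q ∧
      ∀ x, f ![x 0, x 1 ^ 2, x 2] = (x 1 ^ 6 - x 2 ^ 2) * Q x := by
  have hc (i : Fin 3) : ContDiff ℝ ∞ fun x : Fin 3 → ℝ => x i := contDiff_apply ℝ ℝ i
  have hF : ContDiff ℝ ∞ fun x : Fin 3 → ℝ => f ![x 0, x 1 ^ 2, x 2] :=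
    hf.comp (contDiff_vec3 (hc 0) ((hc 1).pow 2) (hc 2))
  obtain ⟨Q₁, hQ₁, h₁⟩ := exists_contDiff_eq_sub_mul 2 hF ((hc 1).pow 3)
    fun x => by simpa using hX _ (vec3_mem_cuspidalEdge (x 0) (x 1))
  have h₂ (x : Fin 3 → ℝ) (hx : x 1 ≠ 0) : Q₁ (Function.update x 2 (-x 1 ^ 3)) = 0 := by
    have h := h₁ (Function.update x 2 (-x 1 ^ 3))
    have h' := hX _ (vec3_mem_cuspidalEdge (x 0) (-x 1))
    rw [neg_sq, Odd.neg_pow (by decide : Odd 3)] at h'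
    simp [h'] at h
    exact h.resolve_left fun h => hx (pow_eq_zero_iff (n := 3) (by simp) |>.1 (by linarith))
  obtain ⟨Q, hQ, h₃⟩ := exists_contDiff_eq_sub_mul 2 hQ₁ ((hc 1).pow 3).neg fun x => by
    by_cases hx : x 1 = 0
    · have hcont : Continuous fun t : ℝ => Q₁ ![x 0, t, -t ^ 3] :=
        hQ₁.continuous.comp (contDiff_vec3 contDiff_const contDiff_id
          (contDiff_id.pow 3).neg).continuous
      have := eq_zero_of_forall_ne_zero hcont fun t ht => by
        convert h₂ ![x 0, t, 0] ht using 2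
        ext j
        fin_cases j <;> simp
      convert this using 2
      ext j
      fin_cases j <;> simp [hx]
    · exact h₂ x hx
  refine ⟨fun x => -Q x, hQ.neg, fun x => ?_⟩
  rw [h₁, h₃]
  change (x 2 - x 1 ^ 3) * ((x 2 - -x 1 ^ 3) * Q x) = (x 1 ^ 6 - x 2 ^ 2) * -Q x
  ring

theorem exists_contDiff_eq_mul_add_mul {f : (Fin 3 → ℝ) → ℝ} (hf : ContDiff ℝ ∞ f)
    (hX : ∀ x ∈ cuspidalEdge, f x = 0) :
    ∃ a g : (Fin 3 → ℝ) → ℝ, ContDiff ℝ ∞ a ∧ ContDiff ℝ ∞ g ∧ (∀ x ∈ cuspidalEdge, g x = 0) ∧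
      ∀ x, f x = (x 1 ^ 3 - x 2 ^ 2) * a x + x 1 * g x := by
  have hc (i : Fin 3) : ContDiff ℝ ∞ fun x : Fin 3 → ℝ => x i := contDiff_apply ℝ ℝ i
  obtain ⟨Q, hQ, h⟩ := exists_contDiff_pullback_eq_mul hf hX
  have ha : ContDiff ℝ ∞ fun x : Fin 3 → ℝ => Q (Function.update x 1 0) :=
    hQ.comp (contDiff_update 1 contDiff_const)
  obtain ⟨g, hg, hfg⟩ := exists_contDiff_eq_sub_mul 1 (s := fun _ => 0)
    (hf.sub ((((hc 1).pow 3).sub ((hc 2).pow 2)).mul ha)) contDiff_const fun x => by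
      have h1 := h (Function.update x 1 0)
      have h2 : (![x 0, 0, x 2] : Fin 3 → ℝ) = Function.update x 1 0 := by
        ext j
        fin_cases j <;> simp
      simp [h2] at h1
      simp [h1]
  simp only [sub_zero] at hfg
  have hne (x : Fin 3 → ℝ) (hx : x ∈ cuspidalEdge) (h1 : x 1 ≠ 0) : g x = 0 := by
    have h2 := hfg x
    rw [mem_cuspidalEdge_iff] at hx
    simpa [hX x hx, hx, h1] using h2
  refine ⟨_, g, ha, hg, fun x hx => ?_, fun x => ?_⟩
  · by_cases h1 : x 1 = 0
    · have hcont : Continuous fun t : ℝ => g ![x 0, t ^ 2, t ^ 3] :=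
        hg.continuous.comp (contDiff_vec3 contDiff_const (contDiff_id.pow 2)
          (contDiff_id.pow 3)).continuous
      have := eq_zero_of_forall_ne_zero hcont fun t ht =>
        hne _ (vec3_mem_cuspidalEdge _ _) (by simpa using ht)
      rw [mem_cuspidalEdge_iff, h1] at hx
      have h2 : x 2 = 0 := by simpa using hx.symm
      convert this using 2
      ext j
      fin_cases j <;> simp [h1, h2]
    · exact hne x hx h1
  · linarith [hfg x]

theorem exists_contDiff_eq_mul_add_pow_mul {f : (Fin 3 → ℝ) → ℝ} (hf : ContDiff ℝ ∞ f)
    (hX : ∀ x ∈ cuspidalEdge, f x = 0) (N : ℕ) :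
    ∃ a g : (Fin 3 → ℝ) → ℝ, ContDiff ℝ ∞ a ∧ ContDiff ℝ ∞ g ∧ (∀ x ∈ cuspidalEdge, g x = 0) ∧
      ∀ x, f x = (x 1 ^ 3 - x 2 ^ 2) * a x + x 1 ^ N * g x := by
  induction N with
  | zero => exact ⟨fun _ => 0, f, contDiff_const, hf, hX, by simp⟩
  | succ N ih =>
    obtain ⟨a, g, ha, hg, hgX, h⟩ := ih
    obtain ⟨a', g', ha', hg', hgX', h'⟩ := exists_contDiff_eq_mul_add_mul hg hgX
    refine ⟨fun x => a x + x 1 ^ N * a' x, g',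
      ha.add (((contDiff_apply ℝ ℝ 1).pow N).mul ha'), hg', hgX', fun x => ?_⟩
    rw [h, h']
    ring

/-- The derivative of `ℓ³ / (ℓ³ + c²)`, in a form without denominators. -/
theorem exists_hasFDerivAt_cube_div {E : Type} [NormedAddCommGroup E] [NormedSpace ℝ E]
    (ℓ c : E →L[ℝ] ℝ) {x : E} (hx : 0 < ℓ x) :
    ∃ φ' : E →L[ℝ] ℝ, HasFDerivAt (fun x => ℓ x ^ 3 / (ℓ x ^ 3 + c x ^ 2)) φ' x ∧
      ℓ x ^ 3 • φ' = (3 * ℓ x ^ 2 * (ℓ x ^ 3 / (ℓ x ^ 3 + c x ^ 2))) • ℓ -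
        ((ℓ x ^ 3 / (ℓ x ^ 3 + c x ^ 2)) ^ 2) • ((3 * ℓ x ^ 2) • ℓ + (2 * c x) • c) := by
  have hd : ℓ x ^ 3 + c x ^ 2 ≠ 0 := by positivity
  have h1 := (ℓ.hasFDerivAt (x := x)).pow 3
  have h2 := (c.hasFDerivAt (x := x)).pow 2
  refine ⟨_, h1.mul ((hasDerivAt_inv hd).comp_hasFDerivAt x (h1.add h2)), ?_⟩
  ext v
  simp
  field_simp
  ring

/-- The quotient is a sum of two flat extensions: over `v > 0` with `φ = √v`, and over `ℓ = -v > 0`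
with `φ = ℓ³ / (ℓ³ + w²) ≤ 1`. The second `φ` absorbs three powers of `ℓ`, whence the exponent `3 *
k + 5`. -/
theorem exists_contDiff_pow_mul_eq_mul {f : (Fin 3 → ℝ) → ℝ} (hf : ContDiff ℝ ∞ f)
    (hX : ∀ x ∈ cuspidalEdge, f x = 0) (k : ℕ) :
    ∃ q : (Fin 3 → ℝ) → ℝ, ContDiff ℝ k q ∧
      ∀ x, x 1 ^ (3 * k + 5) * f x = (x 1 ^ 3 - x 2 ^ 2) * q x := by
  obtain ⟨Q, hQ, h⟩ := exists_contDiff_pullback_eq_mul hf hX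
  set p : Fin 3 → (Fin 3 → ℝ) →L[ℝ] ℝ := fun i => ContinuousLinearMap.proj i with hp
  have hc (i : Fin 3) : ContDiff ℝ ∞ fun z : (Fin 3 → ℝ) × ℝ => z.1 i :=
    (contDiff_apply ℝ ℝ i).comp contDiff_fst
  have h₁ : ContDiff ℝ k (flatExtension (p 1) (fun x => √(x 1)) (3 * k + 5)
      fun z => Q ![z.1 0, z.2, z.1 2]) := by
    -- `v³ d(√v) = (√v)⁵ / 2 dv`.
    refine contDiff_flatExtension (m := fun z => (z.2 ^ 5 / 2) • p 1)
      (((contDiff_snd.pow 5).div_const 2).smul contDiff_const) (fun x₀ => ⟨√(x₀ 1) + 1, ?_⟩)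
      (fun x hx => ?_) k (hQ.comp (contDiff_vec3 (hc 0) contDiff_snd (hc 2))) (by lia)
    · have hcont : Continuous fun x : Fin 3 → ℝ => √(x 1) := by fun_prop
      filter_upwards [hcont.continuousAt.eventually_lt continuousAt_const
        (lt_add_one (√(x₀ 1)))] with x hx _
      rw [abs_of_nonneg (Real.sqrt_nonneg _)]
      exact hx.le
    · change 0 < x 1 at hx
      refine ⟨_, (p 1).hasFDerivAt.sqrt hx.ne', ?_⟩
      rw [smul_smul]
      congr 1
      change x 1 ^ 3 * (1 / (2 * √(x 1))) = √(x 1) ^ 5 / 2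
      have hs : 0 < √(x 1) := Real.sqrt_pos.2 hx
      field_simp
      rw [show √(x 1) ^ 6 = (√(x 1) ^ 2) ^ 3 by ring, Real.sq_sqrt hx.le]
  have h₂ : ContDiff ℝ k (flatExtension (-p 1)
      (fun x => (-p 1) x ^ 3 / ((-p 1) x ^ 3 + p 2 x ^ 2)) (3 * k + 2)
      fun z => (-1) ^ (3 * k + 6) * (z.2 * f z.1)) := by
    refine contDiff_flatExtension (m := fun z => (3 * (-p 1) z.1 ^ 2 * z.2) • (-p 1) -
        (z.2 ^ 2) • ((3 * (-p 1) z.1 ^ 2) • (-p 1) + (2 * p 2 z.1) • p 2)) ?_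
      (fun x₀ => ⟨1, Filter.Eventually.of_forall fun x hx => ?_⟩)
      (fun x hx => exists_hasFDerivAt_cube_div _ _ hx) k
      (contDiff_const.mul (contDiff_snd.mul (hf.comp contDiff_fst))) le_rfl
    · fun_prop
    · rw [abs_of_nonneg (by positivity)]
      exact div_le_one_of_le₀ (le_add_of_nonneg_right (sq_nonneg _)) (by positivity)
  refine ⟨_, h₁.add h₂, fun x => ?_⟩
  simp only [flatExtension, hp, ContinuousLinearMap.proj_apply, neg_apply,
    smul_eq_mul]
  rcases lt_trichotomy (x 1) 0 with hx | hx | hx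
  · have hd : (-x 1) ^ 3 + x 2 ^ 2 ≠ 0 := by
      have : 0 < -x 1 := by linarith
      positivity
    rw [if_neg hx.not_gt, if_pos (neg_pos.2 hx)]
    obtain ⟨t, ht⟩ : ∃ t, x 1 = -t := ⟨-x 1, (neg_neg _).symm⟩
    rw [ht, neg_neg] at hd ⊢
    rw [neg_pow t (3 * k + 5), pow_succ (-1 : ℝ) (3 * k + 5), pow_add t (3 * k + 2) 3]
    generalize (-1 : ℝ) ^ (3 * k + 5) = e
    field_simp
    ring
  · simp [hx]
  · rw [if_pos hx, if_neg (by linarith)]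
    have h3 := h ![x 0, √(x 1), x 2]
    have h4 : ![x 0, x 1, x 2] = x := by
      ext j
      fin_cases j <;> rfl
    simp [Real.sq_sqrt hx.le, h4] at h3
    rw [h3, show √(x 1) ^ 6 = (√(x 1) ^ 2) ^ 3 by ring, Real.sq_sqrt hx.le]
    ring

/-- On each line parallel to the `w`-axis the equation has finitely many zeros, so cancellation
holds on a dense set. -/
theorem eq_of_cuspidalEdge_mul_eq {q r : (Fin 3 → ℝ) → ℝ} (hq : Continuous q) (hr : Continuous r)
    (h : ∀ x : Fin 3 → ℝ, (x 1 ^ 3 - x 2 ^ 2) * q x = (x 1 ^ 3 - x 2 ^ 2) * r x) : q = r := by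
  ext x
  have hfin : {t : ℝ | x 1 ^ 3 - t ^ 2 = 0}.Finite := by
    refine (Set.toFinite {√(x 1 ^ 3), -√(x 1 ^ 3)}).subset fun t ht => ?_
    have ht' : x 1 ^ 3 = t ^ 2 := sub_eq_zero.1 ht
    rw [ht', Real.sqrt_sq_eq_abs]
    rcases abs_choice t with h | h <;> simp [h]
  have hu : Continuous fun t : ℝ => Function.update x 2 t :=
    continuous_const.update 2 continuous_id
  have := congrFun ((hq.comp hu).ext_on (hfin.countable.dense_compl ℝ) (hr.comp hu) fun t ht => by
    have := h (Function.update x 2 t)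
    simp only [Function.update_self, ne_eq, show (1 : Fin 3) ≠ 2 by decide, not_false_eq_true,
      Function.update_of_ne] at this
    exact mul_left_cancel₀ ht this) (x 2)
  simpa using this

/-- A smooth function that vanishes on the cuspidal edge is divisible by its equation. -/
theorem exists_contDiff_eq_mul_of_eqOn_cuspidalEdge {f : (Fin 3 → ℝ) → ℝ} (hf : ContDiff ℝ ∞ f)
    (hX : ∀ x ∈ cuspidalEdge, f x = 0) :
    ∃ q : (Fin 3 → ℝ) → ℝ, ContDiff ℝ ∞ q ∧ ∀ x, f x = (x 1 ^ 3 - x 2 ^ 2) * q x := by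
  have key (k : ℕ) : ∃ q : (Fin 3 → ℝ) → ℝ, ContDiff ℝ k q ∧
      ∀ x, f x = (x 1 ^ 3 - x 2 ^ 2) * q x := by
    obtain ⟨a, g, ha, hg, hgX, h⟩ := exists_contDiff_eq_mul_add_pow_mul hf hX (3 * k + 5)
    obtain ⟨q, hq, h'⟩ := exists_contDiff_pow_mul_eq_mul hg hgX k
    refine ⟨fun x => a x + q x, (contDiff_infty.1 ha k).add hq, fun x => ?_⟩
    rw [h, h']
    ring
  choose q hq h using key
  refine ⟨q 0, contDiff_infty.2 fun k => ?_, h 0⟩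
  rw [eq_of_cuspidalEdge_mul_eq (hq 0).continuous (hq k).continuous
    fun x => (h 0 x).symm.trans (h k x)]
  exact hq k

/-! ### Global representatives of germs. -/

theorem exists_contDiff_eq_one_mul {n : ℕ} {f : (Fin n → ℝ) → ℝ} {s : Set (Fin n → ℝ)}
    (hs : s ∈ 𝓝 0) (hf : ContDiffOn ℝ ∞ f s) :
    ∃ χ : (Fin n → ℝ) → ℝ, (∀ᶠ x in 𝓝 0, χ x = 1) ∧ (∀ x ∉ s, χ x = 0) ∧
      ContDiff ℝ ∞ fun x => χ x * f x := by
  obtain ⟨r, hr, hrs⟩ := Metric.mem_nhds_iff.1 hs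
  let χ : ContDiffBump (0 : Fin n → ℝ) := ⟨r / 4, r / 2, by positivity, by linarith⟩
  have hχ : tsupport χ ⊆ Metric.ball 0 r := by
    rw [χ.tsupport_eq]
    exact Metric.closedBall_subset_ball (by change r / 2 < r; linarith)
  refine ⟨χ, χ.eventuallyEq_one, fun x hx => image_eq_zero_of_notMem_tsupport
    fun h => hx (hrs (hχ h)), contDiff_iff_contDiffAt.2 fun x => ?_⟩
  by_cases hx : x ∈ tsupport χ
  · exact χ.contDiff.contDiffAt.mul (hf.contDiffAt (Filter.mem_of_superset
      (Metric.isOpen_ball.mem_nhds (hχ hx)) hrs))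
  · refine (contDiffAt_const (c := (0 : ℝ))).congr_of_eventuallyEq ?_
    filter_upwards [notMem_tsupport_iff_eventuallyEq.1 hx] with y hy
    simp [hy]

/-- The germ of a smooth function on the whole space. -/
def SmoothGerm.of {n : ℕ} (f : (Fin n → ℝ) → ℝ) (hf : ContDiff ℝ ∞ f) : SmoothGerm n :=
  ⟨(f : Filter.Germ (𝓝 (0 : Fin n → ℝ)) ℝ), f, Set.univ, isOpen_univ, trivial,
    hf.contDiffOn, rfl⟩

section Germ

variable {n : ℕ} {f g : (Fin n → ℝ) → ℝ} {hf : ContDiff ℝ ∞ f} {hg : ContDiff ℝ ∞ g}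

theorem SmoothGerm.of_eq_of : SmoothGerm.of f hf = SmoothGerm.of g hg ↔ f =ᶠ[𝓝 0] g := by
  exact Subtype.ext_iff.trans Filter.Germ.coe_eq

theorem SmoothGerm.of_add :
    SmoothGerm.of f hf + SmoothGerm.of g hg = SmoothGerm.of (fun x => f x + g x) (hf.add hg) := rfl

theorem SmoothGerm.of_mul :
    SmoothGerm.of f hf * SmoothGerm.of g hg = SmoothGerm.of (fun x => f x * g x) (hf.mul hg) := rfl

theorem SmoothGerm.of_pow (k : ℕ) :
    SmoothGerm.of f hf ^ k = SmoothGerm.of (fun x => f x ^ k) (hf.pow k) := rfl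

theorem SmoothGerm.two_eq_of :
    (2 : SmoothGerm n) = SmoothGerm.of (fun _ => 2) contDiff_const := rfl

theorem SmoothGerm.three_eq_of :
    (3 : SmoothGerm n) = SmoothGerm.of (fun _ => 3) contDiff_const := rfl

theorem coord_eq_of (i : Fin n) :
    coord i = SmoothGerm.of (fun x => x i) (contDiff_apply ℝ ℝ i) := rfl

theorem partialDeriv_of (i : Fin n) :
    partialDeriv i (SmoothGerm.of f hf) = SmoothGerm.of (fun x => fderiv ℝ f x (Pi.single i 1))
      ((hf.fderiv_right (m := ∞) (by simp)).clm_apply contDiff_const) := rfl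

theorem SmoothGerm.exists_eq_of (φ : SmoothGerm n) : ∃ f hf, φ = SmoothGerm.of f hf := by
  obtain ⟨_, f, U, hU, h0, hf, rfl⟩ := φ
  obtain ⟨χ, hχ, -, h⟩ := exists_contDiff_eq_one_mul (hU.mem_nhds h0) hf
  refine ⟨_, h, Subtype.ext (Filter.Germ.coe_eq.2 ?_)⟩
  filter_upwards [hχ] with x hx
  simp [hx]

theorem SmoothGerm.of_mem_vanishingIdeal {X : Set (Fin n → ℝ)} :
    SmoothGerm.of f hf ∈ vanishingIdeal X ↔ ∀ᶠ x in 𝓝 0, x ∈ X → f x = 0 := by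
  refine ⟨fun ⟨g, hfg, hg⟩ => ?_, fun h => ⟨f, rfl, h⟩⟩
  filter_upwards [Filter.Germ.coe_eq.1 hfg, hg] with x hx hx' hX
  rw [hx, hx' hX]

/-- The cutoff is supported where the representative already vanishes on `X`, so vanishing becomes
global and the global division lemma applies. -/
theorem exists_eq_of_of_mem_vanishingIdeal {X : Set (Fin n → ℝ)} {φ : SmoothGerm n}
    (hφ : φ ∈ vanishingIdeal X) : ∃ f hf, φ = SmoothGerm.of f hf ∧ ∀ x ∈ X, f x = 0 := by
  obtain ⟨f, hf, rfl⟩ := SmoothGerm.exists_eq_of φ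
  rw [SmoothGerm.of_mem_vanishingIdeal] at hφ
  obtain ⟨χ, hχ, h0, h⟩ := exists_contDiff_eq_one_mul hφ hf.contDiffOn
  refine ⟨_, h, SmoothGerm.of_eq_of.2 ?_, fun x hx => ?_⟩
  · filter_upwards [hχ] with x hx
    simp [hx]
  · by_cases hs : x ∈ X → f x = 0
    · simp [hs hx]
    · simp [h0 x hs]

end Germ

/-! ### The three fields are tangent. -/

theorem exists_eq_cusp {x : Fin 3 → ℝ} (hx : x ∈ cuspidalEdge) :
    ∃ y, x = ![x 0, y ^ 2, y ^ 3] := by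
  rw [mem_cuspidalEdge_iff] at hx
  have h : ∃ y, x 1 = y ^ 2 ∧ x 2 = y ^ 3 := by
    by_cases h1 : x 1 = 0
    · exact ⟨0, by simpa using h1, by simpa [h1] using hx.symm⟩
    · refine ⟨x 2 / x 1, ?_, ?_⟩
      · field_simp
        linarith
      · field_simp
        rw [hx]
        ring
  obtain ⟨y, h1, h2⟩ := h
  refine ⟨y, ?_⟩
  ext j
  fin_cases j
  exacts [rfl, h1, h2]

theorem hasDerivAt_cusp (u y : ℝ) :
    HasDerivAt (fun t : ℝ => (![u, t ^ 2, t ^ 3] : Fin 3 → ℝ)) ![0, 2 * y, 3 * y ^ 2] y := by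
  refine hasDerivAt_pi.2 fun j => ?_
  fin_cases j
  · exact hasDerivAt_const y u
  · simpa using hasDerivAt_pow 2 y
  · simpa using hasDerivAt_pow 3 y

theorem fderiv_zero_of_eqOn_cuspidalEdge {f : (Fin 3 → ℝ) → ℝ} (hf : ContDiff ℝ ∞ f)
    (hX : ∀ x ∈ cuspidalEdge, f x = 0) {x : Fin 3 → ℝ} (hx : x ∈ cuspidalEdge) :
    fderiv ℝ f x (Pi.single 0 1) = 0 := by
  have h1 : HasDerivAt (fun t : ℝ => x + t • Pi.single 0 1) (Pi.single (M := fun _ => ℝ) 0 1) 0 := by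
    simpa using ((hasDerivAt_id (0 : ℝ)).smul_const (Pi.single (M := fun _ => ℝ) 0 1)).const_add x
  have h2 := (hf.differentiable (by simp)
    (x + (0 : ℝ) • Pi.single 0 1)).hasFDerivAt.comp_hasDerivAt 0 h1
  have h3 : (f ∘ fun t : ℝ => x + t • Pi.single 0 1) = fun _ => 0 := by
    ext t
    refine hX _ ?_
    rw [mem_cuspidalEdge_iff] at hx ⊢
    simpa using hx
  rw [h3] at h2
  simpa using h2.unique (hasDerivAt_const _ _)

theorem fderiv_cusp_of_eqOn_cuspidalEdge {f : (Fin 3 → ℝ) → ℝ} (hf : ContDiff ℝ ∞ f)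
    (hX : ∀ x ∈ cuspidalEdge, f x = 0) (u y : ℝ) :
    2 * y * fderiv ℝ f ![u, y ^ 2, y ^ 3] (Pi.single 1 1) +
      3 * y ^ 2 * fderiv ℝ f ![u, y ^ 2, y ^ 3] (Pi.single 2 1) = 0 := by
  have h := (hf.differentiable (by simp) ![u, y ^ 2, y ^ 3]).hasFDerivAt.comp_hasDerivAt y
    (hasDerivAt_cusp u y)
  have h3 : (f ∘ fun t : ℝ => ![u, t ^ 2, t ^ 3]) = fun _ => 0 :=
    funext fun t => hX _ (vec3_mem_cuspidalEdge u t)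
  rw [h3] at h
  rw [← h.unique (hasDerivAt_const _ _), ← smul_eq_mul (2 * y), ← smul_eq_mul (3 * y ^ 2),
    ← map_smul, ← map_smul, ← map_add]
  congr 1
  ext j
  fin_cases j <;> simp

theorem xi_mem_tangentFields :
    xi₁ ∈ tangentFields cuspidalEdge ∧ xi₂ ∈ tangentFields cuspidalEdge ∧
      xi₃ ∈ tangentFields cuspidalEdge := by
  refine ⟨fun φ hφ => ?_, fun φ hφ => ?_, fun φ hφ => ?_⟩ <;>
    obtain ⟨f, hf, rfl, hX⟩ := exists_eq_of_of_mem_vanishingIdeal hφ <;>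
    simp only [lieApply, xi₁, xi₂, xi₃, coordField, Fin.sum_univ_three, partialDeriv_of,
      Pi.add_apply, Pi.smul_apply, smul_eq_mul, Pi.single_apply, Fin.reduceEq, if_true, if_false,
      mul_one, mul_zero, zero_mul, one_mul, add_zero, zero_add, SmoothGerm.two_eq_of,
      SmoothGerm.three_eq_of, coord_eq_of, SmoothGerm.of_mul, SmoothGerm.of_add, SmoothGerm.of_pow,
      SmoothGerm.of_mem_vanishingIdeal] <;>
    refine Filter.Eventually.of_forall fun x hx => ?_
  · exact fderiv_zero_of_eqOn_cuspidalEdge hf hX hx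
  all_goals
    obtain ⟨y, hy⟩ := exists_eq_cusp hx
    have h := fderiv_cusp_of_eqOn_cuspidalEdge hf hX (x 0) y
    rw [← hy] at h
    have h1 : x 1 = y ^ 2 := congrFun hy 1
    have h2 : x 2 = y ^ 3 := congrFun hy 2
    rw [h1, h2]
  -- At `(u, y², y³)`, `ξ₂` and `ξ₃` are `y` and `y²` times the velocity of the cusp.
  · linear_combination y * h
  · linear_combination y ^ 2 * h

/-! ### Every tangent field is a combination of the three. -/

/-- The coefficients of a field tangent to the cuspidal edge vanish along its singular axis. -/
theorem eventually_eq_zero_of_tangent {b c : (Fin 3 → ℝ) → ℝ} (hb : ContDiff ℝ ∞ b)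
    (hc : ContDiff ℝ ∞ c)
    (h : ∀ᶠ x in 𝓝 0, x ∈ cuspidalEdge → 3 * x 1 ^ 2 * b x = 2 * x 2 * c x) :
    ∀ᶠ x in 𝓝 (0 : Fin 3 → ℝ), x 1 = 0 → x 2 = 0 → b x = 0 ∧ c x = 0 := by
  filter_upwards [h.eventually_nhds] with x hx h1 h2
  have hx0 : ![x 0, (0 : ℝ) ^ 2, (0 : ℝ) ^ 3] = x := by
    ext j
    fin_cases j <;> simp [h1, h2]
  have hγ := hasDerivAt_cusp (x 0) 0
  have hγc := hγ.continuousAt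
  rw [ContinuousAt, hx0] at hγc
  have hb' := (hb.differentiable (by simp)
    ![x 0, (0 : ℝ) ^ 2, (0 : ℝ) ^ 3]).hasFDerivAt.comp_hasDerivAt 0 hγ
  have hc' := (hc.differentiable (by simp)
    ![x 0, (0 : ℝ) ^ 2, (0 : ℝ) ^ 3]).hasFDerivAt.comp_hasDerivAt 0 hγ
  -- Along the cusp `γ`, tangency reads `t³ (3t b(γ t) - 2 c(γ t)) = 0`. The bracket thus vanishes
  -- near 0: its value at 0 gives `c = 0`, and its derivative, as `γ' 0 = 0`, gives `3b = 0`.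
  have hk := (((hasDerivAt_id (0 : ℝ)).const_mul 3).mul hb').sub (hc'.const_mul 2)
  have hne : (fun t : ℝ => 3 * t * b ![x 0, t ^ 2, t ^ 3] - 2 * c ![x 0, t ^ 2, t ^ 3])
      =ᶠ[𝓝[≠] 0] fun _ => 0 := by
    filter_upwards [eventually_nhdsWithin_of_eventually_nhds (hγc.eventually hx),
      self_mem_nhdsWithin] with t ht ht0
    have h3 := ht (vec3_mem_cuspidalEdge _ _)
    simp only [Matrix.cons_val_one, Matrix.cons_val] at h3
    exact mul_left_cancel₀ (pow_ne_zero 3 ht0) (by linear_combination h3)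
  have h0 := (hk.continuousAt.eventuallyEq_nhds_iff_eventuallyEq_nhdsNE continuousAt_const).1 hne
  have hc0 : c x = 0 := by
    have h3 : 3 * 0 * b ![x 0, 0 ^ 2, 0 ^ 3] - 2 * c ![x 0, 0 ^ 2, 0 ^ 3] = 0 := h0.self_of_nhds
    rw [hx0] at h3
    linarith
  have hb0 := (hk.congr_of_eventuallyEq h0.symm).unique (hasDerivAt_const _ _)
  have hv : (![0, 2 * 0, 3 * 0 ^ 2] : Fin 3 → ℝ) = 0 := by
    ext j
    fin_cases j <;> simp
  simp only [hv, map_zero, Function.comp_apply, hx0] at hb0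
  exact ⟨by simpa using hb0, hc0⟩

theorem tangentFields_le_span :
    tangentFields cuspidalEdge ≤ Submodule.span (SmoothGerm 3) {xi₁, xi₂, xi₃} := by
  intro ξ hξ
  obtain ⟨a, ha, ha'⟩ := SmoothGerm.exists_eq_of (ξ 0)
  obtain ⟨b, hb, hb'⟩ := SmoothGerm.exists_eq_of (ξ 1)
  obtain ⟨c, hc, hc'⟩ := SmoothGerm.exists_eq_of (ξ 2)
  have hx (i : Fin 3) : ContDiff ℝ ∞ fun x : Fin 3 → ℝ => x i := contDiff_apply ℝ ℝ i
  have htan : ∀ᶠ x in 𝓝 0, x ∈ cuspidalEdge → 3 * x 1 ^ 2 * b x = 2 * x 2 * c x := by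
    have h := hξ (SmoothGerm.of (fun x => x 1 ^ 3 - x 2 ^ 2) (((hx 1).pow 3).sub ((hx 2).pow 2)))
      (SmoothGerm.of_mem_vanishingIdeal.2 (Filter.Eventually.of_forall fun x hx =>
        sub_eq_zero.2 hx))
    have hd (x : Fin 3 → ℝ) (i : Fin 3) :
        fderiv ℝ (fun x : Fin 3 → ℝ => x 1 ^ 3 - x 2 ^ 2) x (Pi.single i 1) =
          3 * x 1 ^ 2 * Pi.single (M := fun _ => ℝ) i 1 1 -
            2 * x 2 * Pi.single (M := fun _ => ℝ) i 1 2 := by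
      have h : HasFDerivAt (fun x : Fin 3 → ℝ => x 1 ^ 3 - x 2 ^ 2) _ x :=
        ((hasFDerivAt_apply (𝕜 := ℝ) (F' := fun _ => ℝ) (1 : Fin 3) x).pow 3).sub
          ((hasFDerivAt_apply (𝕜 := ℝ) (F' := fun _ => ℝ) (2 : Fin 3) x).pow 2)
      rw [h.fderiv]
      simp
    simp only [lieApply, Fin.sum_univ_three, partialDeriv_of, ha', hb', hc', SmoothGerm.of_mul,
      SmoothGerm.of_add, SmoothGerm.of_mem_vanishingIdeal, hd] at h
    filter_upwards [h] with x h1 h2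
    have h3 := h1 h2
    simp at h3
    linarith
  have haxis := eventually_eq_zero_of_tangent hb hc htan
  -- `b` vanishes on the axis only near the origin, while `χ b` vanishes on all of it.
  obtain ⟨χ, hχ, hχ0, hχb⟩ := exists_contDiff_eq_one_mul
    (haxis.mono fun x h h1 h2 => (h h1 h2).1) hb.contDiffOn
  obtain ⟨b₁, hb₁, h₁⟩ := exists_contDiff_sub_update 1 (s := fun _ => 0) hχb contDiff_const
  obtain ⟨b₂, hb₂, h₂⟩ := exists_contDiff_eq_sub_mul 2 (s := fun _ => 0)
    (hχb.comp (contDiff_update 1 (s := fun _ => 0) contDiff_const)) contDiff_const fun x => by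
      by_cases hs : b (Function.update (Function.update x 2 0) 1 0) = 0
      · simp [hs]
      · simp only [Function.comp_apply]
        rw [hχ0 _ fun h => hs (h (by simp) (by simp)), zero_mul]
  have hbb : ∀ᶠ x in 𝓝 0, b x = x 1 * b₁ x + x 2 * b₂ x := by
    filter_upwards [hχ] with x hx
    have h3 := h₁ x
    have h4 := h₂ x
    simp only [Function.comp_apply] at h4
    rw [h4, hx] at h3
    linarith
  -- The `∂w`-coefficient left after subtracting `(b₁ ξ₂ + b₂ ξ₃) / 2`.
  have hc₁ : ContDiff ℝ ∞ fun x => c x - 3 / 2 * (x 2 * b₁ x + x 1 ^ 2 * b₂ x) :=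
    hc.sub (contDiff_const.mul (((hx 2).mul hb₁).add (((hx 1).pow 2).mul hb₂)))
  have hcX : SmoothGerm.of _ hc₁ ∈ vanishingIdeal cuspidalEdge := by
    rw [SmoothGerm.of_mem_vanishingIdeal]
    filter_upwards [htan, haxis, hbb] with x h3 h4 h5 h6
    by_cases h7 : x 2 = 0
    · have h8 : x 1 = 0 := by simpa [mem_cuspidalEdge_iff, h7] using h6
      simp [h7, h8, (h4 h8 h7).2]
    · have h8 := h3 h6
      rw [mem_cuspidalEdge_iff] at h6
      refine mul_left_cancel₀ h7 ?_
      rw [h5] at h8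
      linear_combination -h8 / 2 + 3 / 2 * b₁ x * h6
  obtain ⟨g, hg, hcg, hgX⟩ := exists_eq_of_of_mem_vanishingIdeal hcX
  rw [SmoothGerm.of_eq_of] at hcg
  obtain ⟨q, hq, hgq⟩ := exists_contDiff_eq_mul_of_eqOn_cuspidalEdge hg hgX
  rw [Submodule.mem_span_triple]
  -- The terms in `q` come from `(v³ - w²) q ∂w = q (v ξ₃ - w ξ₂) / 3`.
  refine ⟨SmoothGerm.of a ha,
    SmoothGerm.of (fun x => b₁ x / 2 - x 2 * q x / 3)
      ((hb₁.div_const 2).sub (((hx 2).mul hq).div_const 3)),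
    SmoothGerm.of (fun x => b₂ x / 2 + x 1 * q x / 3)
      ((hb₂.div_const 2).add (((hx 1).mul hq).div_const 3)), ?_⟩
  ext1 i
  fin_cases i <;>
    simp only [xi₁, xi₂, xi₃, coordField, Fin.zero_eta, Fin.mk_one, Fin.reduceFinMk,
      Pi.add_apply, Pi.smul_apply, smul_eq_mul, Pi.single_apply, Fin.reduceEq, if_true, if_false,
      mul_one, mul_zero, add_zero, zero_add, SmoothGerm.two_eq_of, SmoothGerm.three_eq_of,
      coord_eq_of, SmoothGerm.of_mul, SmoothGerm.of_add, SmoothGerm.of_pow, ha', hb', hc',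
      SmoothGerm.of_eq_of]
  · filter_upwards [hbb] with x h3
    rw [h3]
    ring
  · filter_upwards [hcg] with x h3
    rw [hgq] at h3
    linear_combination -h3

end CuspidalEdge

theorem proposition3p1 :
    CuspidalEdge.tangentFields CuspidalEdge.cuspidalEdge =
      Submodule.span (CuspidalEdge.SmoothGerm 3)
        {CuspidalEdge.xi₁, CuspidalEdge.xi₂, CuspidalEdge.xi₃} := by
  refine le_antisymm CuspidalEdge.tangentFields_le_span (Submodule.span_le.2 ?_)
  rintro _ (rfl | rfl | rfl)
  exacts [CuspidalEdge.xi_mem_tangentFields.1, CuspidalEdge.xi_mem_tangentFields.2.1,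
    CuspidalEdge.xi_mem_tangentFields.2.2]
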